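/- Let $G$ be a triangulated plane graph with $n\ge 4$ vertices, that is, a finite simple graph together with a fixed planar embedding in which every face, including the outer face, is bounded by a triangle. A triangle of $G$ (three pairwise adjacent vertices) is called filled if at least one vertex of $G$ lies strictly inside the closed curve formed by its three edges. Then at most $2n-5$ edges of $G$ belong to some filled triangle. Here the planar embedding is given combinatorially: by a cyclic order of the incident edges around each vertex such that $G$ is connected and the faces traced by these orders satisfy $|V|-|E|+|F|=2$ (that is, the embedding is on the sphere), together with a choice of one face as the outer face. A face is inside a triangle if every way to reach it from the outer face, passing from face to face across edges, crosses an edge of the triangle; a vertex is strictly inside a triangle if it is not on the triangle and is incident to a face inside it. -/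

import Mathlib

/-- A rotation system (combinatorial embedding) of a simple graph `G`: at every vertex `v`, a
cyclic order of the darts (oriented edges) that leave `v`.  The permutation `next` sends each dart
to the next one in, say, clockwise order around its starting vertex. -/
structure RotationSystem {V : Type*} (G : SimpleGraph V) where
  next : Equiv.Perm G.Dart
  fst_next : ∀ d : G.Dart, (next d).fst = d.fst
  sameCycle : ∀ d e : G.Dart, d.fst = e.fst → next.SameCycle d e

namespace RotationSystem

variable {V : Type*} {G : SimpleGraph V} (R : RotationSystem G)

/-- Tracing a face: after going along a dart from `u` to `v`, continue with the dart that follows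
the reversed dart (from `v` to `u`) in the cyclic order around `v`. -/
def facePerm : Equiv.Perm G.Dart :=
  (Function.Involutive.toPerm SimpleGraph.Dart.symm SimpleGraph.Dart.symm_involutive).trans R.next

/-- The faces are the orbits of the face tracing permutation. -/
def Face : Type _ :=
  Quotient (Equiv.Perm.SameCycle.setoid R.facePerm)

/-- The face on whose boundary walk the dart `d` lies, that is, the face on one fixed side of `d`.
The face on the other side of the same edge is `R.face d.symm`. -/
def face (d : G.Dart) : R.Face :=
  Quotient.mk (Equiv.Perm.SameCycle.setoid R.facePerm) d

/-- The Euler characteristic `|V| - |E| + |F|` of the closed surface described by the rotation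
system (for a connected finite graph with at least one edge). -/
noncomputable def eulerCharacteristic : ℤ :=
  (Nat.card V : ℤ) - Nat.card G.edgeSet + Nat.card R.Face

end RotationSystem

/-- An embedding in the plane of a connected finite simple graph with at least one edge: a rotation
system whose surface is the sphere (a closed connected orientable surface is the sphere exactly if
its Euler characteristic is `2`), together with the face that is chosen to be the unbounded one. -/
structure PlaneEmbedding {V : Type*} [Finite V] (G : SimpleGraph V) extends RotationSystem G where
  connected : G.Connected
  spherical : toRotationSystem.eulerCharacteristic = 2
  outerFace : toRotationSystem.Face

namespace PlaneEmbedding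

variable {V : Type*} [Finite V] {G : SimpleGraph V} (P : PlaneEmbedding G)

/-- All faces, including the outer face, are triangles: every boundary walk consists of exactly
three darts (and hence, the graph being simple, runs around three distinct vertices). -/
def IsTriangulated : Prop :=
  ∀ f : P.Face, {d : G.Dart | P.face d = f}.ncard = 3

/-- Two faces are joined across an edge that does not belong to `C`. -/
def AdjacentOff (C : Set (Sym2 V)) (f g : P.Face) : Prop :=
  ∃ d : G.Dart, d.edge ∉ C ∧ P.face d = f ∧ P.face d.symm = g

/-- The face `f` lies inside the closed curve formed by the edges in `C`: it cannot be reached from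
the outer face without crossing an edge of `C`. -/
def FaceInside (C : Set (Sym2 V)) (f : P.Face) : Prop :=
  ¬ Relation.ReflTransGen (P.AdjacentOff C) P.outerFace f

end PlaneEmbedding

/-- The edges of `G` with both ends in `T`; for a triangle `T`, its three edges. -/
def triangleEdges {V : Type*} (G : SimpleGraph V) (T : Finset V) : Set (Sym2 V) :=
  {e | e ∈ G.edgeSet ∧ ∀ v ∈ e, v ∈ T}

namespace PlaneEmbedding

variable {V : Type*} [Finite V] {G : SimpleGraph V} (P : PlaneEmbedding G)

/-- The vertex `v` lies strictly inside the triangle `T`: it is not a vertex of `T`, and it is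
incident to a face inside `T`.  (All faces around a vertex that is not on `T` are on the same side
of `T`, as consecutive ones share an edge at that vertex.) -/
def StrictlyInside (T : Finset V) (v : V) : Prop :=
  v ∉ T ∧ ∃ d : G.Dart, d.fst = v ∧ P.FaceInside (triangleEdges G T) (P.face d)

/-- A filled triangle: three pairwise adjacent vertices with some vertex strictly inside the
triangle that they form. -/
def IsFilledTriangle (T : Finset V) : Prop :=
  G.IsNClique 3 T ∧ ∃ v : V, P.StrictlyInside T v

/-- The edges that belong to some filled triangle. -/
def filledTriangleEdges : Set (Sym2 V) :=
  {e | ∃ T : Finset V, P.IsFilledTriangle T ∧ e ∈ triangleEdges G T}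

end PlaneEmbedding

/-!
The proof shows that the edges lying in no filled triangle form a connected spanning subgraph. Such
a subgraph has at least `n - 1` edges, while Euler's formula gives `3 n - 6` edges in all, so at
most `2 n - 5` edges are left for the filled triangles.

Suppose that, for some set `A` of vertices, every edge between `A` and its complement lies in a
filled triangle (`PlaneEmbedding.IsTriangulated.not_isFilledTriangle_of_crossing`). Let `T` be a
filled triangle with such a crossing edge `ab`, having as few faces inside as possible. One of the
two faces at `ab` is inside `T`; its third vertex `x` is strictly inside `T`, since otherwise that
face would fill `T` entirely. One of `xa` and `xb` is again crossing, hence lies in a filled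
triangle `T'`. As `T'` contains a vertex strictly inside `T`, fewer faces lie inside `T'` than
inside `T`, a contradiction.

The part of the Jordan curve theorem used here is that every edge of a filled triangle has exactly
one of its two faces inside (`PlaneEmbedding.IsFilledTriangle.symm_iff_not`). It follows from two
facts: a set of faces is bounded by an even number of edges at each vertex
(`RotationSystem.sum_add_symm_eq_zero`), and a set of faces that is bounded by no edge at all is
empty or everything (`PlaneEmbedding.mem_of_symm_closed`).
-/

namespace RotationSystem

variable {V : Type*} {G : SimpleGraph V} (R : RotationSystem G)

/-! ### Faces and darts -/

theorem facePerm_apply (d : G.Dart) : R.facePerm d = R.next d.symm := rfl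

theorem facePerm_fst (d : G.Dart) : (R.facePerm d).fst = d.snd :=
  R.fst_next d.symm

theorem face_facePerm (d : G.Dart) : R.face (R.facePerm d) = R.face d :=
  Quotient.sound (Equiv.Perm.SameCycle.symm ⟨1, by simp⟩)

theorem face_symm (d : G.Dart) : R.face d.symm = R.face (R.next d) := by
  rw [← face_facePerm, facePerm_apply, SimpleGraph.Dart.symm_symm]

theorem exists_face_eq (f : R.Face) : ∃ d, R.face d = f :=
  Quotient.exists_rep f

theorem face_eq_iff {d e : G.Dart} : R.face d = R.face e ↔ R.facePerm.SameCycle d e :=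
  ⟨fun h => Quotient.exact h, fun h => Quotient.sound h⟩

instance finite_dart [Finite V] : Finite G.Dart :=
  Finite.of_injective _ SimpleGraph.Dart.toProd_injective

instance finite_face [Finite V] : Finite R.Face :=
  inferInstanceAs (Finite (Quotient _))

/-- A property of faces that is preserved by crossing the edges at `v` holds at one corner of `v`
only if it holds at all of them. -/
theorem forall_corner [Finite V] (p : R.Face → Prop) (v : V)
    (h : ∀ d : G.Dart, d.fst = v → p (R.face d) → p (R.face d.symm)) {d e : G.Dart}
    (hd : d.fst = v) (he : e.fst = v) (hp : p (R.face d)) : p (R.face e) := by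
  classical
  have := Fintype.ofFinite G.Dart
  obtain ⟨i, -, -, rfl⟩ := (R.sameCycle d e (hd.trans he.symm)).exists_pow_eq
  clear he
  induction i generalizing d with
  | zero => simpa using hp
  | succ n ih =>
    rw [pow_succ, Equiv.Perm.mul_apply]
    exact ih ((R.fst_next d).trans hd) (R.face_symm d ▸ h d hd hp)

/-- A set of faces has an even number of bounding edges at each vertex: each face that is entered
when walking once around the vertex is left again. -/
theorem sum_add_symm_eq_zero [Fintype G.Dart] [DecidableEq V] (χ : R.Face → ZMod 2) (v : V) :
    ∑ d : G.Dart with d.fst = v, (χ (R.face d) + χ (R.face d.symm)) = 0 := by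
  have h : ∑ d : G.Dart with d.fst = v, χ (R.face d.symm) =
      ∑ d : G.Dart with d.fst = v, χ (R.face d) :=
    Finset.sum_equiv R.next (by simp [R.fst_next]) (by simp [R.face_symm])
  rw [Finset.sum_add_distrib, h, CharTwo.add_self_eq_zero]

end RotationSystem

theorem mem_triangleEdges {V : Type*} {G : SimpleGraph V} {T : Finset V} {u v : V} :
    s(u, v) ∈ triangleEdges G T ↔ G.Adj u v ∧ u ∈ T ∧ v ∈ T := by
  simp [triangleEdges]

theorem dart_edge_mem_triangleEdges {V : Type*} {G : SimpleGraph V} {T : Finset V} {d : G.Dart} :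
    d.edge ∈ triangleEdges G T ↔ d.fst ∈ T ∧ d.snd ∈ T :=
  mem_triangleEdges.trans (and_iff_right d.adj)

namespace PlaneEmbedding

variable {V : Type*} [Finite V] {G : SimpleGraph V} (P : PlaneEmbedding G)

/-- The dual graph is connected: a set of faces that is closed under crossing edges contains all
faces if it contains one. -/
theorem mem_of_symm_closed (p : P.Face → Prop) (h : ∀ d : G.Dart, p (P.face d) → p (P.face d.symm))
    {f : P.Face} (hf : p f) (g : P.Face) : p g := by
  obtain ⟨d, rfl⟩ := P.exists_face_eq f
  obtain ⟨e, rfl⟩ := P.exists_face_eq g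
  have key : ∀ v, G.Reachable d.fst v → ∀ e : G.Dart, e.fst = v → p (P.face e) := by
    rintro v ⟨w⟩
    generalize hu : d.fst = u at w
    induction w generalizing d with
    | nil => exact fun e he => P.forall_corner p _ (fun d _ => h d) hu he hf
    | cons hadj w ih =>
      let b : G.Dart := ⟨(_, _), hadj⟩
      have hb : p (P.face b) := P.forall_corner p _ (fun d _ => h d) hu rfl hf
      exact ih b.symm (h b hb) rfl
  exact key _ (P.connected.preconnected _ _) e rfl

/-! ### The two sides of a triangle -/

/-- If a set of faces is bounded only by edges of a triangle, then the two edges of the triangle at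
a given vertex both bound it or both do not. -/
theorem boundary_iff_boundary {T : Finset V} (p : P.Face → Prop)
    (hp : ∀ d : G.Dart, d.edge ∉ triangleEdges G T → (p (P.face d) ↔ p (P.face d.symm)))
    (hT : T.card = 3) {d e : G.Dart} (hd : d.edge ∈ triangleEdges G T)
    (he : e.edge ∈ triangleEdges G T) (hde : d.fst = e.fst) (hne : d ≠ e) :
    (p (P.face d) ↔ p (P.face d.symm)) ↔ (p (P.face e) ↔ p (P.face e.symm)) := by
  classical
  have := Fintype.ofFinite G.Dart
  rw [dart_edge_mem_triangleEdges] at hd he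
  have hsnd : d.snd ≠ e.snd := fun h => hne (SimpleGraph.Dart.ext _ _ (Prod.ext hde h))
  have hTeq : T = {d.fst, d.snd, e.snd} := by
    refine (Finset.eq_of_subset_of_card_le ?_ ?_).symm
    · simp [Finset.insert_subset_iff, hd, he]
    · rw [hT, Finset.card_eq_three.2 ⟨_, _, _, d.adj.ne, hde ▸ e.adj.ne, hsnd, rfl⟩]
  let χ : P.Face → ZMod 2 := fun f => if p f then 1 else 0
  have hχ : ∀ f g, χ f + χ g = 0 ↔ (p f ↔ p g) := by
    intro f g
    by_cases hf : p f <;> by_cases hg : p g <;> simp [χ, hf, hg, CharTwo.add_self_eq_zero]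
  have hsum := P.sum_add_symm_eq_zero χ d.fst
  rw [← Finset.sum_subset (s₁ := {d, e}), Finset.sum_pair hne] at hsum
  · rw [← hχ, ← hχ]
    constructor <;> intro h <;> simpa [h] using hsum
  · simp [Finset.insert_subset_iff, hde]
  · intro c hc hcde
    rw [hχ]
    refine hp c fun hcT => hcde ?_
    have hc1 : c.fst = d.fst := by simpa using hc
    have hc2 := (dart_edge_mem_triangleEdges.1 hcT).2
    rw [hTeq] at hc2
    simp only [Finset.mem_insert, Finset.mem_singleton] at hc2 ⊢
    rcases hc2 with h | h | h
    · exact absurd (hc1.trans h.symm) c.adj.ne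
    · exact Or.inl (SimpleGraph.Dart.ext _ _ (Prod.ext hc1 h))
    · exact Or.inr (SimpleGraph.Dart.ext _ _ (Prod.ext (hc1.trans hde) h))

/-- A set of faces that is bounded only by edges of a triangle, but not by all of them, is empty if
it misses some face. -/
theorem not_mem_of_boundary {T : Finset V} (p : P.Face → Prop)
    (hp : ∀ d : G.Dart, d.edge ∉ triangleEdges G T → (p (P.face d) ↔ p (P.face d.symm)))
    (hT : T.card = 3) {d : G.Dart} (hd : d.edge ∈ triangleEdges G T)
    (hdp : p (P.face d) ↔ p (P.face d.symm)) {g : P.Face} (hg : ¬ p g) (f : P.Face) : ¬ p f := by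
  intro hf
  refine hg (P.mem_of_symm_closed p (fun e => ?_) hf g)
  suffices p (P.face e) ↔ p (P.face e.symm) from this.1
  by_cases he : e.edge ∈ triangleEdges G T
  swap
  · exact hp e he
  have hdT := dart_edge_mem_triangleEdges.1 hd
  have heT := dart_edge_mem_triangleEdges.1 he
  -- Two darts on `T` that start at the same vertex.
  have same : ∀ c : G.Dart, c.edge ∈ triangleEdges G T → c.fst = d.fst →
      (p (P.face c) ↔ p (P.face c.symm)) := by
    intro c hc hcd
    by_cases hne : d = c
    · exact hne ▸ hdp
    · exact (P.boundary_iff_boundary p hp hT hd hc hcd.symm hne).1 hdp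
  have same' : ∀ c : G.Dart, c.edge ∈ triangleEdges G T → c.fst = d.snd →
      (p (P.face c) ↔ p (P.face c.symm)) := by
    intro c hc hcd
    by_cases hne : d.symm = c
    · subst hne
      simpa using hdp.symm
    · refine (P.boundary_iff_boundary p hp hT (d := d.symm) (by simpa using hd) hc hcd.symm hne).1 ?_
      simpa using hdp.symm
  by_cases h1 : e.fst = d.fst
  · exact same e he h1
  by_cases h2 : e.fst = d.snd
  · exact same' e he h2
  have hes : e.symm.edge ∈ triangleEdges G T := by simpa using he
  have flip : (p (P.face e.symm) ↔ p (P.face e.symm.symm)) → (p (P.face e) ↔ p (P.face e.symm)) := by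
    rw [SimpleGraph.Dart.symm_symm]
    exact Iff.symm
  -- Otherwise `e` starts at the third vertex, so it ends at one of the ends of `d`.
  by_cases h3 : e.snd = d.fst
  · exact flip (same e.symm hes h3)
  by_cases h4 : e.snd = d.snd
  · exact flip (same' e.symm hes h4)
  classical
  have h5 : ({d.fst, d.snd, e.fst, e.snd} : Finset V).card = 4 := by
    simp [Finset.card_insert_of_notMem, d.adj.ne, e.adj.ne, Ne.symm h1, Ne.symm h2, Ne.symm h3,
      Ne.symm h4]
  have h6 : ({d.fst, d.snd, e.fst, e.snd} : Finset V).card ≤ T.card :=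
    Finset.card_le_card (by simp [Finset.insert_subset_iff, hdT, heT])
  omega

theorem faceInside_iff_symm {C : Set (Sym2 V)} {d : G.Dart} (hd : d.edge ∉ C) :
    P.FaceInside C (P.face d) ↔ P.FaceInside C (P.face d.symm) :=
  not_congr ⟨fun h => h.tail ⟨d, hd, rfl, rfl⟩,
    fun h => h.tail ⟨d.symm, by simpa using hd, rfl, by simp⟩⟩

theorem not_faceInside_outerFace (C : Set (Sym2 V)) : ¬ P.FaceInside C P.outerFace :=
  fun h => h .refl

variable {P}

theorem IsFilledTriangle.card_eq {T : Finset V} (hT : P.IsFilledTriangle T) : T.card = 3 :=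
  hT.1.card_eq

/-- Every edge of a filled triangle has exactly one of its two faces inside the triangle. -/
theorem IsFilledTriangle.symm_iff_not {T : Finset V} (hT : P.IsFilledTriangle T) {d : G.Dart}
    (hd : d.edge ∈ triangleEdges G T) :
    P.FaceInside (triangleEdges G T) (P.face d.symm) ↔
      ¬ P.FaceInside (triangleEdges G T) (P.face d) := by
  obtain ⟨v, -, e, -, he⟩ := hT.2
  by_contra h
  exact P.not_mem_of_boundary _ (fun c hc => P.faceInside_iff_symm hc) hT.card_eq hd (by tauto)
    (P.not_faceInside_outerFace _) _ he

/-- All faces around a vertex strictly inside a triangle are inside the triangle. -/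
theorem StrictlyInside.faceInside {T : Finset V} {v : V} (h : P.StrictlyInside T v) {d : G.Dart}
    (hd : d.fst = v) : P.FaceInside (triangleEdges G T) (P.face d) := by
  obtain ⟨hv, e, he, hin⟩ := h
  refine P.forall_corner _ v (fun c hc => ?_) he hd hin
  refine (P.faceInside_iff_symm fun hcT => hv ?_).1
  exact hc ▸ (dart_edge_mem_triangleEdges.1 hcT).1

theorem StrictlyInside.faceInside_symm {T : Finset V} {v : V} (h : P.StrictlyInside T v)
    {d : G.Dart} (hd : d.fst = v) : P.FaceInside (triangleEdges G T) (P.face d.symm) := by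
  rw [P.face_symm]
  exact h.faceInside ((P.fst_next d).trans hd)

/-- A triangle through a vertex strictly inside `T` has all its inside faces inside `T`. -/
theorem StrictlyInside.faceInside_of_faceInside {T T' : Finset V} {x : V}
    (hx : P.StrictlyInside T x) (hxT' : x ∈ T') (hT' : G.IsNClique 3 T') {f : P.Face}
    (hf : P.FaceInside (triangleEdges G T') f) : P.FaceInside (triangleEdges G T) f := by
  -- The vertices of `T'` are on `T` or strictly inside `T`, as they are equal or adjacent to `x`.
  have inside : ∀ y ∈ T', y ∉ T → P.StrictlyInside T y := by
    intro y hy hyT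
    by_cases hxy : x = y
    · exact hxy ▸ hx
    let d : G.Dart := ⟨(x, y), hT'.1 hxT' hy hxy⟩
    exact ⟨hyT, d.symm, rfl, hx.faceInside_symm (d := d) rfl⟩
  refine fun hreach => hf ?_
  clear hf
  induction hreach with
  | refl => exact .refl
  | tail hg hgh ih =>
    obtain ⟨d, hd, rfl, rfl⟩ := hgh
    -- A face outside `T` has no corner strictly inside `T`, so `d` does not cross `T'`.
    refine ih.tail ⟨d, fun hdT' => ?_, rfl, rfl⟩
    rw [dart_edge_mem_triangleEdges] at hd hdT'
    by_cases h : d.fst ∈ T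
    · refine (inside d.snd hdT'.2 fun h' => hd ⟨h, h'⟩).faceInside_symm (d := d.symm) rfl ?_
      rwa [SimpleGraph.Dart.symm_symm]
    · exact (inside d.fst hdT'.1 h).faceInside rfl hg

/-- A filled triangle through a vertex strictly inside `T` has fewer inside faces than `T`. -/
theorem StrictlyInside.ncard_faceInside_lt {T T' : Finset V} {x : V} (hx : P.StrictlyInside T x)
    (hxT' : x ∈ T') (hT' : P.IsFilledTriangle T') :
    {f | P.FaceInside (triangleEdges G T') f}.ncard <
      {f | P.FaceInside (triangleEdges G T) f}.ncard := by
  refine Set.ncard_lt_ncard ?_ (Set.toFinite _)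
  refine (Set.ssubset_iff_of_subset fun f => hx.faceInside_of_faceInside hxT' hT'.1).2 ?_
  -- An edge of `T'` at `x` has a face outside `T'`, but both of its faces are inside `T`.
  obtain ⟨y, hy, hyx⟩ := Finset.exists_mem_ne (by rw [hT'.card_eq]; norm_num) x
  let d : G.Dart := ⟨(x, y), hT'.1.1 hxT' hy hyx.symm⟩
  have hd : d.edge ∈ triangleEdges G T' := dart_edge_mem_triangleEdges.2 ⟨hxT', hy⟩
  by_cases h : P.FaceInside (triangleEdges G T') (P.face d)
  · exact ⟨P.face d.symm, hx.faceInside_symm (d := d) rfl,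
      fun h' => (hT'.symm_iff_not hd).1 h' h⟩
  · exact ⟨P.face d, hx.faceInside (d := d) rfl, h⟩

/-! ### Triangular faces -/

theorem facePerm_ne (d : G.Dart) : P.facePerm d ≠ d := fun h =>
  d.adj.ne ((congrArg (·.fst) h).symm.trans (P.facePerm_fst d))

theorem IsTriangulated.facePerm_facePerm_ne (hP : P.IsTriangulated) (d : G.Dart) :
    P.facePerm (P.facePerm d) ≠ d := by
  classical
  have := Fintype.ofFinite G.Dart
  intro h
  have hsub : {e : G.Dart | P.face e = P.face d} ⊆ {d, P.facePerm d} := by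
    intro e he
    obtain ⟨i, -, -, rfl⟩ := (P.face_eq_iff.1 (Eq.symm he)).exists_pow_eq
    clear he
    induction i with
    | zero => simp
    | succ n ih =>
      rw [pow_succ', Equiv.Perm.mul_apply]
      rcases ih with h' | h'
      · exact Or.inr (congrArg P.facePerm h')
      · exact Or.inl ((congrArg P.facePerm h').trans h)
  have hle := Set.ncard_le_ncard hsub
  rw [hP, Set.ncard_pair (facePerm_ne d).symm] at hle
  omega

/-- In a triangulation, the three darts of the face at `d` are the first three of its boundary
walk. -/
theorem IsTriangulated.face_eq_iff (hP : P.IsTriangulated) {d e : G.Dart} :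
    P.face e = P.face d ↔ e = d ∨ e = P.facePerm d ∨ e = P.facePerm (P.facePerm d) := by
  have hsub : {d, P.facePerm d, P.facePerm (P.facePerm d)} ⊆
      {e : G.Dart | P.face e = P.face d} := by
    simp [Set.insert_subset_iff, P.face_facePerm]
  have hcard : ({d, P.facePerm d, P.facePerm (P.facePerm d)} : Set G.Dart).ncard = 3 :=
    Set.ncard_eq_three.2 ⟨_, _, _, (facePerm_ne d).symm, (hP.facePerm_facePerm_ne d).symm,
      (facePerm_ne _).symm, rfl⟩
  have heq := Set.eq_of_subset_of_ncard_le hsub (by rw [hP, hcard])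
  simpa using (Set.ext_iff.1 heq e).symm

theorem IsTriangulated.facePerm_facePerm_facePerm (hP : P.IsTriangulated) (d : G.Dart) :
    P.facePerm (P.facePerm (P.facePerm d)) = d := by
  rcases hP.face_eq_iff.1 (show P.face (P.facePerm (P.facePerm (P.facePerm d))) = P.face d by
    simp only [P.face_facePerm]) with h | h | h
  · exact h
  · exact absurd h (hP.facePerm_facePerm_ne _)
  · exact absurd h (facePerm_ne _)

/-- The face at an edge of a filled triangle on its inner side has its third vertex strictly inside
the triangle: otherwise it would be the only face inside. -/
theorem IsTriangulated.strictlyInside_facePerm_snd (hP : P.IsTriangulated) {T : Finset V}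
    (hT : P.IsFilledTriangle T) {d : G.Dart} (hd : d.edge ∈ triangleEdges G T)
    (hin : P.FaceInside (triangleEdges G T) (P.face d)) :
    P.StrictlyInside T (P.facePerm d).snd := by
  have hdT := dart_edge_mem_triangleEdges.1 hd
  have h1 := P.facePerm_fst d
  have h2 := P.facePerm_fst (P.facePerm d)
  have h3 := P.facePerm_fst (P.facePerm (P.facePerm d))
  rw [hP.facePerm_facePerm_facePerm] at h3
  refine ⟨fun hxT => ?_, P.facePerm (P.facePerm d), h2, by simpa [P.face_facePerm] using hin⟩
  obtain ⟨w, hwT, e, rfl, he⟩ := hT.2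
  have hcases : ∀ c : G.Dart, P.face c = P.face d → c.edge ∈ triangleEdges G T := by
    intro c hc
    rw [dart_edge_mem_triangleEdges]
    rcases hP.face_eq_iff.1 hc with rfl | rfl | rfl
    · exact hdT
    · exact ⟨h1 ▸ hdT.2, hxT⟩
    · exact ⟨h2 ▸ hxT, h3 ▸ hdT.1⟩
  have hne : P.face e ≠ P.face d := fun h =>
    hwT (dart_edge_mem_triangleEdges.1 (hcases e h)).1
  -- Without the face at `d`, the inside of `T` is no longer bounded by the edge of `d`.
  refine P.not_mem_of_boundary
    (fun f => P.FaceInside (triangleEdges G T) f ∧ f ≠ P.face d) (fun c hc => ?_) hT.card_eq hd ?_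
    (g := P.face d) (by simp) _ ⟨he, hne⟩
  · have hc1 : P.face c ≠ P.face d := fun h => hc (hcases c h)
    have hc2 : P.face c.symm ≠ P.face d := fun h => hc (by simpa using hcases c.symm h)
    simp [P.faceInside_iff_symm hc, hc1, hc2]
  · simp [hT.symm_iff_not hd, hin]

/-- If all edges between `A` and its complement lie in filled triangles, then no filled triangle
has such an edge: one with the fewest faces inside would contain another one. -/
theorem IsTriangulated.not_isFilledTriangle_of_crossing (hP : P.IsTriangulated) (A : Set V)
    (hA : ∀ u v, G.Adj u v → u ∈ A → v ∉ A → s(u, v) ∈ P.filledTriangleEdges)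
    {T : Finset V} (hT : P.IsFilledTriangle T) {u v : V} (huv : G.Adj u v) (huT : u ∈ T)
    (hvT : v ∈ T) (hu : u ∈ A) (hv : v ∉ A) : False := by
  induction hN : {f | P.FaceInside (triangleEdges G T) f}.ncard using Nat.strong_induction_on
    generalizing T u v with
  | _ N ih =>
  subst hN
  -- The third vertex of the inner face at `uv`.
  obtain ⟨x, hx, hux, hvx⟩ : ∃ x, P.StrictlyInside T x ∧ G.Adj u x ∧ G.Adj v x := by
    have key : ∀ d : G.Dart, d.edge ∈ triangleEdges G T →
        P.FaceInside (triangleEdges G T) (P.face d) →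
        ∃ x, P.StrictlyInside T x ∧ G.Adj d.fst x ∧ G.Adj d.snd x := by
      intro d hd hin
      have h1 := (P.facePerm d).adj
      have h2 := (P.facePerm (P.facePerm d)).adj
      have h3 := P.facePerm_fst (P.facePerm (P.facePerm d))
      rw [hP.facePerm_facePerm_facePerm] at h3
      rw [P.facePerm_fst, ← h3] at h2
      rw [P.facePerm_fst] at h1
      exact ⟨_, hP.strictlyInside_facePerm_snd hT hd hin, h2.symm, h1⟩
    let d : G.Dart := ⟨(u, v), huv⟩
    have hd : d.edge ∈ triangleEdges G T := dart_edge_mem_triangleEdges.2 ⟨huT, hvT⟩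
    by_cases hin : P.FaceInside (triangleEdges G T) (P.face d)
    · exact key d hd hin
    · obtain ⟨x, hx, h1, h2⟩ := key d.symm (by simpa using hd) ((hT.symm_iff_not hd).2 hin)
      exact ⟨x, hx, h2, h1⟩
  by_cases hxA : x ∈ A
  · obtain ⟨T', hT', he⟩ := hA x v hvx.symm hxA hv
    obtain ⟨hadj, hxT', hvT'⟩ := mem_triangleEdges.1 he
    exact ih _ (hx.ncard_faceInside_lt hxT' hT') hT' hadj hxT' hvT' hxA hv rfl
  · obtain ⟨T', hT', he⟩ := hA u x hux hu hxA
    obtain ⟨hadj, huT', hxT'⟩ := mem_triangleEdges.1 he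
    exact ih _ (hx.ncard_faceInside_lt hxT' hT') hT' hadj huT' hxT' hu hxA rfl

/-! ### Counting edges -/

/-- The edges in no filled triangle form a connected spanning subgraph. -/
theorem IsTriangulated.connected_deleteEdges (hP : P.IsTriangulated) :
    (G.deleteEdges P.filledTriangleEdges).Connected := by
  have := P.connected.nonempty
  refine ⟨fun a b => ?_⟩
  by_contra hab
  let A : Set V := {v | (G.deleteEdges P.filledTriangleEdges).Reachable a v}
  have hA : ∀ u v, G.Adj u v → u ∈ A → v ∉ A → s(u, v) ∈ P.filledTriangleEdges := by
    intro u v huv hu hv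
    by_contra he
    exact hv (hu.trans (SimpleGraph.Adj.reachable (SimpleGraph.deleteEdges_adj.2 ⟨huv, he⟩)))
  obtain ⟨w⟩ := P.connected.preconnected a b
  obtain ⟨d, -, hu, hv⟩ := w.exists_boundary_dart A SimpleGraph.Reachable.rfl hab
  obtain ⟨T, hT, he⟩ := hA _ _ d.adj hu hv
  obtain ⟨huT, hvT⟩ := dart_edge_mem_triangleEdges.1 he
  exact hP.not_isFilledTriangle_of_crossing A hA hT d.adj huT hvT hu hv

/-- Every edge has two darts and every face has three. -/
theorem IsTriangulated.three_mul_card_face (hP : P.IsTriangulated) :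
    3 * Nat.card P.Face = 2 * Nat.card G.edgeSet := by
  classical
  have := Fintype.ofFinite V
  have := Fintype.ofFinite P.Face
  have h1 : Fintype.card G.Dart = 2 * Nat.card G.edgeSet := by
    rw [G.dart_card_eq_twice_card_edges, Nat.card_eq_fintype_card, SimpleGraph.edgeFinset_card]
  rw [← h1, ← Finset.card_univ,
    Finset.card_eq_sum_card_fiberwise (f := P.face) (t := Finset.univ) (by simp),
    Finset.sum_congr rfl (g := fun _ => 3), Finset.sum_const, Finset.card_univ,
    Nat.card_eq_fintype_card, smul_eq_mul, mul_comm]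
  intro f _
  rw [← hP f, ← Set.ncard_coe_finset]
  simp

end PlaneEmbedding

theorem mainTheorem11 {V : Type*} [Finite V] (G : SimpleGraph V) (P : PlaneEmbedding G)
    (hP : P.IsTriangulated) (hn : 4 ≤ Nat.card V) :
    P.filledTriangleEdges.ncard ≤ 2 * Nat.card V - 5 := by
  have hsub : P.filledTriangleEdges ⊆ G.edgeSet := fun e ⟨_, _, he⟩ => he.1
  have htree := hP.connected_deleteEdges.card_vert_le_card_edgeSet_add_one
  rw [SimpleGraph.edgeSet_deleteEdges, Nat.card_coe_set_eq, Set.ncard_sdiff hsub] at htree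
  have hle := Set.ncard_le_ncard hsub
  have hface := hP.three_mul_card_face
  have heuler := P.spherical
  rw [RotationSystem.eulerCharacteristic] at heuler
  rw [Nat.card_coe_set_eq] at hface heuler
  omega
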